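/- Let $q\in(0,1]$, and let $R=R(SU_q(2))$ be the fusion algebra of $SU_q(2)$ with its quantum dimension function: the ring $\mathbb{Z}[I]$ with basis $I=\operatorname{Irr}(SU_q(2))=\{0,1,2,\dots\}$, unit $0$, trivial involution $\bar n=n$, multiplication given by the fusion rules $$m\otimes n=|m-n|\oplus(|m-n|+2)\oplus\cdots\oplus(m+n),$$ and dimension function $d$ determined by $d(0)=1$, $d(1)=q+q^{-1}$ and $d(n)d(1)=d(n-1)+d(n+1)$ for $n\ge 1$. For a finite set $X\subseteq I$ and $\alpha\in I$, write $\alpha\subseteq x_1\cdots x_n$ if $\alpha$ occurs with non-zero coefficient in the product $x_1\cdots x_n$; the set $X$ is called generating if $\overline X=X$ and every $\alpha\in I$ satisfies $\alpha\subseteq x_1\cdots x_n$ for some $n\geq 1$ and $x_1,\dots,x_n\in X$. Let $\rho$ be the right regular representation of the $*$-algebra $\mathbb{C}[I]$ on $\ell^2(I)$, i.e. $\rho(\alpha)\delta_\beta=\sum_{\eta\in I}N_{\beta,\bar\alpha}^{\eta}\delta_\eta$ for $\alpha,\beta\in I$, where $N_{\beta,\bar\alpha}^{\eta}$ is the multiplicity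 of $\eta$ in $\beta\otimes\bar\alpha$. Then $R$ is finitely generated (some finite subset of $I$ is generating), $\rho$ has no non-zero invariant vectors (vectors $\xi$ with $\rho(\alpha)\xi=d(\alpha)\xi$ for all $\alpha\in I$), and the uniform Kazhdan constant of $\rho$, $$\operatorname{Kaz}(\rho,R)=\inf_{X\subseteq I\ \text{finite, generating}}\ \ \inf_{\xi\in\ell^2(I),\,\|\xi\|=1}\ \ \max_{\alpha\in X}\ \frac{\|\rho(\alpha)\xi-d(\alpha)\xi\|}{d(\alpha)},$$ is given by $$\operatorname{Kaz}(\rho,R)=1-\frac{2}{[2]_q}=\frac{(1-q)^2}{q^2+1},$$ where $[x]_q=\frac{q^{-x}-q^x}{q^{-1}-q}$ for $0<q<1$ and $[x]_1=x$. -/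

import Mathlib

open scoped ENNReal

/-- A fusion algebra with set of irreducible objects `I`: the multiplication of `ℤ[I]` is given by
the structure constants `N ξ η α`, so that `ξ η = ∑ α, N ξ η α • α` (a finite sum). Multiplication,
involution and dimension function are recorded on the basis `I` and extended linearly below. -/
structure FusionAlgebra (I : Type*) where
  /-- the distinguished element `e` -/
  e : I
  /-- the involution `α ↦ ᾱ` -/
  conj : I → I
  /-- the fusion multiplicities -/
  N : I → I → I →₀ ℕ
  /-- the dimension function -/
  d : I → ℝ
  conj_conj : ∀ α, conj (conj α) = α
  e_mul : ∀ ξ, N e ξ = Finsupp.single ξ 1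
  mul_e : ∀ ξ, N ξ e = Finsupp.single ξ 1
  mul_assoc : ∀ ξ η ζ α, ((N ξ η).sum fun β n => n * N β ζ α) = (N η ζ).sum fun β n => n * N ξ β α
  conj_mul : ∀ ξ η α, N ξ η (conj α) = N (conj η) (conj ξ) α
  frobenius_right : ∀ ξ η α, N ξ η α = N α (conj η) ξ
  frobenius_left : ∀ ξ η α, N ξ η α = N (conj ξ) α η
  d_mul : ∀ ξ η, d ξ * d η = (N ξ η).sum fun α n => (n : ℝ) * d α
  d_conj : ∀ α, d (conj α) = d α
  one_le_d : ∀ α, 1 ≤ d α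

namespace FusionAlgebra

variable {I : Type*}

/-- The underlying module `k[I]` of the fusion algebra with coefficients in `k`: for `k = ℤ` this is
the fusion ring `R = ℤ[I]`, for `k = ℂ` its complexification. -/
def Alg (_R : FusionAlgebra I) (k : Type*) [CommRing k] : Type _ := I →₀ k

section Algebra

variable (R : FusionAlgebra I) (k : Type*) [CommRing k]

noncomputable instance : AddCommGroup (R.Alg k) := inferInstanceAs (AddCommGroup (I →₀ k))
noncomputable instance : Module k (R.Alg k) := inferInstanceAs (Module k (I →₀ k))

/-- The basis element of `k[I]` given by `α ∈ I`. -/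
noncomputable def basis (α : I) : R.Alg k := (Finsupp.single α 1 : I →₀ k)

variable {R k} in
/-- The coefficient of `x ∈ k[I]` at `α ∈ I`. -/
def coeff (x : R.Alg k) (α : I) : k := (show I →₀ k from x) α

/-- The product `ξ η = ∑ α, N ξ η α • α` of two basis elements. -/
noncomputable def basisMul (ξ η : I) : R.Alg k := (R.N ξ η).sum fun α n => (n : k) • R.basis k α

/-- The linear extension of a map defined on `I`. -/
noncomputable def ext {M : Type*} [AddCommGroup M] [Module k M] (f : I → M) : R.Alg k →ₗ[k] M :=
  Finsupp.linearCombination k f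

variable {R k} in
@[simp] lemma ext_basis {M : Type*} [AddCommGroup M] [Module k M] (f : I → M) (α : I) :
    R.ext k f (R.basis k α) = f α := by
  have := Finsupp.linearCombination_single k (v := f) 1 α
  rw [one_smul] at this
  exact this

variable {R k} in
lemma hom_ext {M : Type*} [AddCommGroup M] [Module k M] {f g : R.Alg k →ₗ[k] M}
    (h : ∀ α, f (R.basis k α) = g (R.basis k α)) : f = g := by
  refine Finsupp.lhom_ext' (R := k) (M := k) (α := I) fun α => LinearMap.ext_ring ?_
  exact h α

variable {R k} in
@[elab_as_elim]
lemma alg_induction {p : R.Alg k → Prop} (x : R.Alg k) (basis : ∀ α, p (R.basis k α))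
    (add : ∀ x y, p x → p y → p (x + y)) (smul : ∀ (c : k) x, p x → p (c • x)) : p x := by
  refine Finsupp.induction_linear (motive := p) x ?_ add fun α c => ?_
  · by_cases hI : Nonempty I
    · have := smul 0 _ (basis hI.some)
      rwa [zero_smul] at this
    · have : IsEmpty I := not_nonempty_iff.1 hI
      exact (this.false R.e).elim
  · have := smul c _ (basis α)
    have h : c • R.basis k α = (Finsupp.single α c : I →₀ k) := by
      change c • (Finsupp.single α 1 : I →₀ k) = _
      simp
    rwa [h] at this

/-- The multiplication of `k[I]`, as a bilinear map. -/
noncomputable def mulMap : R.Alg k →ₗ[k] R.Alg k →ₗ[k] R.Alg k :=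
  R.ext k fun ξ => R.ext k fun η => R.basisMul k ξ η

noncomputable instance : Mul (R.Alg k) := ⟨fun x y => R.mulMap k x y⟩
noncomputable instance : One (R.Alg k) := ⟨R.basis k R.e⟩

variable {R k}

lemma mul_def (x y : R.Alg k) : x * y = R.mulMap k x y := rfl
lemma one_def : (1 : R.Alg k) = R.basis k R.e := rfl

lemma basis_mul_basis (ξ η : I) : R.basis k ξ * R.basis k η = R.basisMul k ξ η := by
  simp [mul_def, mulMap]

lemma basisMul_apply (ξ η α : I) :
    coeff (R.basisMul k ξ η) α = (R.N ξ η α : k) := by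
  classical
  have h : (R.basisMul k ξ η : I →₀ k)
      = (R.N ξ η).sum fun α n => Finsupp.single α (n : k) := by
    refine Finset.sum_congr rfl fun β _ => ?_
    change (R.N ξ η β : k) • (Finsupp.single β 1 : I →₀ k) = _
    simp
  rw [coeff, h, Finsupp.sum_apply, Finsupp.sum]
  simp only [Finsupp.single_apply]
  rw [Finset.sum_ite_eq']
  split_ifs with hs
  · rfl
  · simp [Finsupp.notMem_support_iff.1 hs]

lemma basis_apply [DecidableEq I] (α β : I) :
    coeff (R.basis k α) β = if α = β then 1 else 0 := by
  unfold coeff basis; rw [Finsupp.single_apply]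

lemma sum_apply' {ι : Type*} (s : Finset ι) (f : ι → R.Alg k) (α : I) :
    coeff (∑ i ∈ s, f i) α = ∑ i ∈ s, coeff (f i) α :=
  Finsupp.finsetSum_apply s f α

lemma basis_assoc (ξ η ζ : I) :
    R.basis k ξ * R.basis k η * R.basis k ζ = R.basis k ξ * (R.basis k η * R.basis k ζ) := by
  rw [basis_mul_basis, basis_mul_basis, basisMul, basisMul, Finsupp.sum, Finsupp.sum]
  simp only [mul_def, map_sum, map_smul, LinearMap.sum_apply, LinearMap.smul_apply]
  simp only [← mul_def, basis_mul_basis]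
  refine Finsupp.ext fun α => ?_
  refine (sum_apply' _ _ α).trans (Eq.trans ?_ (sum_apply' _ _ α).symm)
  have h := congrArg (Nat.cast : ℕ → k) (R.mul_assoc ξ η ζ α)
  simp only [Finsupp.sum, Nat.cast_sum, Nat.cast_mul] at h
  simp only [← basisMul_apply (R := R) (k := k)] at h
  convert h using 2 <;>
  · rw [basisMul_apply]; rfl

noncomputable instance : Ring (R.Alg k) where
  __ := (inferInstance : AddCommGroup (R.Alg k))
  left_distrib x y z := by simp [mul_def]
  right_distrib x y z := by simp [mul_def]
  zero_mul x := by simp [mul_def]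
  mul_zero x := by simp [mul_def]
  one_mul x := by
    have h : R.mulMap k 1 = LinearMap.id := hom_ext fun α => by
      rw [← mul_def, one_def, basis_mul_basis, basisMul, R.e_mul]
      simp
    rw [mul_def, h]; rfl
  mul_one x := by
    have h : (R.mulMap k).flip 1 = LinearMap.id := hom_ext fun α => by
      rw [LinearMap.flip_apply, ← mul_def, one_def, basis_mul_basis, basisMul, R.mul_e]
      simp
    exact LinearMap.congr_fun h x
  mul_assoc x y z := by
    induction x using alg_induction with
    | add x x' hx hx' => simp only [mul_def, map_add, LinearMap.add_apply] at *; rw [hx, hx']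
    | smul c x hx => simp only [mul_def, map_smul, LinearMap.smul_apply] at *; rw [hx]
    | basis ξ =>
    induction y using alg_induction with
    | add x x' hx hx' => simp only [mul_def, map_add, LinearMap.add_apply] at *; rw [hx, hx']
    | smul c x hx => simp only [mul_def, map_smul, LinearMap.smul_apply] at *; rw [hx]
    | basis η =>
    induction z using alg_induction with
    | add x x' hx hx' => simp only [mul_def, map_add] at *; rw [hx, hx']
    | smul c x hx => simp only [mul_def, map_smul] at *; rw [hx]
    | basis ζ => exact basis_assoc ξ η ζ

noncomputable instance : Algebra k (R.Alg k) :=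
  Algebra.ofModule (fun c x y => by simp [mul_def]) (fun c x y => by simp [mul_def])

/-- The involution of the index set as a permutation. -/
def conjEquiv (R : FusionAlgebra I) : I ≃ I := ⟨R.conj, R.conj, R.conj_conj, R.conj_conj⟩

variable [StarRing k]

/-- The (antilinear) extension of the involution `α ↦ ᾱ` to `k[I]`. -/
noncomputable instance : Star (R.Alg k) :=
  ⟨fun x => (Finsupp.mapRange star (star_zero k) (Finsupp.equivMapDomain R.conjEquiv x) : I →₀ k)⟩

lemma star_apply (x : R.Alg k) (α : I) :
    coeff (star x) α = star (coeff x (R.conj α)) := rfl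

lemma star_add' (x y : R.Alg k) : star (x + y) = star x + star y := by
  refine Finsupp.ext fun α => ?_
  exact star_add (coeff x (R.conj α)) (coeff y (R.conj α))

lemma star_smul' (c : k) (x : R.Alg k) : star (c • x) = star c • star x := by
  refine Finsupp.ext fun α => ?_
  exact star_mul' c (coeff x (R.conj α))

lemma star_basis (α : I) : star (R.basis k α) = R.basis k (R.conj α) := by
  classical
  refine Finsupp.ext fun β => ?_
  refine (star_apply _ β).trans ?_
  rw [basis_apply]
  refine Eq.trans ?_ (basis_apply (R.conj α) β).symm
  have : α = R.conj β ↔ R.conj α = β :=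
    ⟨fun h => by rw [h, R.conj_conj], fun h => by rw [← h, R.conj_conj]⟩
  by_cases h : α = R.conj β
  · rw [if_pos h, if_pos (this.1 h), star_one]
  · rw [if_neg h, if_neg (fun h' => h (this.2 h')), star_zero]

lemma star_basisMul (ξ η : I) :
    star (R.basisMul k ξ η) = R.basisMul k (R.conj η) (R.conj ξ) := by
  refine Finsupp.ext fun α => ?_
  refine (star_apply _ α).trans ?_
  rw [basisMul_apply, R.conj_mul, star_natCast]
  exact (basisMul_apply _ _ α).symm

noncomputable instance : StarRing (R.Alg k) where
  star_involutive x := by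
    refine Finsupp.ext fun α => ?_
    refine (star_apply _ α).trans ?_
    rw [star_apply, star_star, R.conj_conj]
    rfl
  star_mul x y := by
    induction x using alg_induction with
    | add x x' hx hx' => rw [add_mul, star_add', star_add', hx, hx', mul_add]
    | smul c x hx => rw [smul_mul_assoc, star_smul', star_smul', hx, mul_smul_comm]
    | basis ξ =>
    induction y using alg_induction with
    | add x x' hx hx' => rw [mul_add, star_add', star_add', hx, hx', add_mul]
    | smul c x hx => rw [mul_smul_comm, star_smul', star_smul', hx, smul_mul_assoc]
    | basis η =>
      rw [star_basis, star_basis, basis_mul_basis, basis_mul_basis, star_basisMul]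
  star_add := star_add'

instance : StarModule k (R.Alg k) := ⟨star_smul'⟩

end Algebra

/-! Generating sets -/

/-- A finite symmetric set `X` of irreducible objects generates `R` if each irreducible object is
contained in some product `x₁ ⋯ xₙ` (`n ≥ 1`) of elements of `X`. -/
def Generates (R : FusionAlgebra I) (X : Finset I) : Prop :=
  (∀ x ∈ X, R.conj x ∈ X) ∧
    ∀ α : I, ∃ l : List I, l ≠ [] ∧ (∀ x ∈ l, x ∈ X) ∧
      coeff (l.map (R.basis ℤ)).prod α ≠ 0

/-! Kazhdan constants of representations of the complexified fusion algebra -/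

section Kazhdan

variable (R : FusionAlgebra I) {H : Type*} [NormedAddCommGroup H] [InnerProductSpace ℂ H]
  [CompleteSpace H]

/-- The invariant vectors of a unital `*`-representation `π` of `ℂ[I]`. -/
def fix (π : R.Alg ℂ →⋆ₐ[ℂ] (H →L[ℂ] H)) : Set H :=
  {ξ | ∀ α : I, π (R.basis ℂ α) ξ = (R.d α : ℂ) • ξ}

/-- The Kazhdan constant of `π` with respect to `X`; the inner supremum is a maximum over the
finite set `X`. -/
noncomputable def kazOn (X : Finset I) (π : R.Alg ℂ →⋆ₐ[ℂ] (H →L[ℂ] H)) : ℝ :=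
  ⨅ ξ : {ξ : H // ‖ξ‖ = 1}, ⨆ α : X,
    ‖π (R.basis ℂ (α : I)) (ξ : H) - (R.d α : ℂ) • (ξ : H)‖ / R.d α

/-- The uniform Kazhdan constant of `π`: the infimum over all finite generating sets. -/
noncomputable def kaz (π : R.Alg ℂ →⋆ₐ[ℂ] (H →L[ℂ] H)) : ℝ :=
  ⨅ X : {X : Finset I // R.Generates X}, R.kazOn X π

end Kazhdan

/-! The right regular representation on `ℓ²(I)` -/

section Regular

variable (R : FusionAlgebra I)

/-- The function `ρ(α) ξ` on `I`. By Frobenius reciprocity `N η α β = N β ᾱ η`, so this is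
`η ↦ ∑ β, N β ᾱ η * ξ β`; see `rhoBasis_single`. -/
noncomputable def rhoFun (α : I) (ξ : I → ℂ) (η : I) : ℂ := (R.N η α).sum fun β n => (n : ℂ) * ξ β

lemma d_pos (α : I) : 0 < R.d α := lt_of_lt_of_le one_pos (R.one_le_d α)

lemma norm_rhoFun_sq_le (α : I) (ξ : I → ℂ) (η : I) :
    ‖R.rhoFun α ξ η‖ ^ 2 ≤
      R.d α * ∑ β ∈ (R.N η α).support, (R.N η α β * R.d η) * (‖ξ β‖ ^ 2 / R.d β) := by
  have h1 : ‖R.rhoFun α ξ η‖ ≤ ∑ β ∈ (R.N η α).support, (R.N η α β : ℝ) * ‖ξ β‖ := by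
    refine (norm_sum_le _ _).trans (le_of_eq (Finset.sum_congr rfl fun β _ => ?_))
    simp
  have h2 : (∑ β ∈ (R.N η α).support, (R.N η α β : ℝ) * ‖ξ β‖) ^ 2 ≤
      (∑ β ∈ (R.N η α).support, (R.N η α β : ℝ) * R.d β) *
        ∑ β ∈ (R.N η α).support, (R.N η α β : ℝ) * (‖ξ β‖ ^ 2 / R.d β) := by
    refine Finset.sum_sq_le_sum_mul_sum_of_sq_le_mul _ (fun β _ => ?_) (fun β _ => ?_)
      (fun β _ => ?_)
    · exact mul_nonneg (Nat.cast_nonneg _) (R.d_pos β).le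
    · have := R.d_pos β
      positivity
    · have := (R.d_pos β).ne'
      refine le_of_eq ?_
      field_simp
  have h3 := R.d_mul η α
  rw [Finsupp.sum] at h3
  rw [← h3] at h2
  calc ‖R.rhoFun α ξ η‖ ^ 2 ≤ _ := pow_le_pow_left₀ (norm_nonneg _) h1 2
    _ ≤ _ := h2
    _ = _ := by
      rw [mul_comm (R.d η), _root_.mul_assoc, Finset.mul_sum]
      congr 1
      refine Finset.sum_congr rfl fun β _ => by ring

lemma sum_rhoFun_sq_le (α : I) (ξ : lp (fun _ : I => ℂ) 2) (S : Finset I) :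
    ∑ η ∈ S, ‖R.rhoFun α ξ η‖ ^ 2 ≤ (R.d α * ‖ξ‖) ^ 2 := by
  classical
  let T : Finset I := S.biUnion fun η => (R.N η α).support
  have hT : ∀ η ∈ S, (R.N η α).support ⊆ T := fun η hη =>
    Finset.subset_biUnion_of_mem (fun η => (R.N η α).support) hη
  have hcol : ∀ β, ∑ η ∈ S, (R.N η α β * R.d η : ℝ) ≤ R.d β * R.d α := by
    intro β
    have h := R.d_mul β (R.conj α)
    rw [R.d_conj] at h
    rw [h, Finsupp.sum]
    calc ∑ η ∈ S, (R.N η α β * R.d η : ℝ)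
        = ∑ η ∈ S with R.N β (R.conj α) η ≠ 0, (R.N β (R.conj α) η * R.d η : ℝ) := by
          rw [Finset.sum_filter]
          refine Finset.sum_congr rfl fun η _ => ?_
          rw [R.frobenius_right η α β]
          split_ifs with h0
          · rfl
          · push Not at h0
            simp [h0]
      _ ≤ _ := by
          refine Finset.sum_le_sum_of_subset_of_nonneg (fun η hη => ?_) fun η _ _ => ?_
          · rw [Finsupp.mem_support_iff]; exact (Finset.mem_filter.1 hη).2
          · exact mul_nonneg (Nat.cast_nonneg _) (R.d_pos η).le
  calc ∑ η ∈ S, ‖R.rhoFun α ξ η‖ ^ 2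
      ≤ ∑ η ∈ S, R.d α * ∑ β ∈ T, (R.N η α β * R.d η) * (‖ξ β‖ ^ 2 / R.d β) := by
        refine Finset.sum_le_sum fun η hη => (R.norm_rhoFun_sq_le α ξ η).trans ?_
        refine mul_le_mul_of_nonneg_left ?_ (R.d_pos α).le
        refine Finset.sum_le_sum_of_subset_of_nonneg (hT η hη) fun β _ _ => ?_
        have := R.d_pos β
        have := R.d_pos η
        positivity
    _ = R.d α * ∑ β ∈ T, (∑ η ∈ S, (R.N η α β * R.d η : ℝ)) * (‖ξ β‖ ^ 2 / R.d β) := by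
        rw [← Finset.mul_sum, Finset.sum_comm]
        simp only [Finset.sum_mul]
    _ ≤ R.d α * ∑ β ∈ T, (R.d β * R.d α) * (‖ξ β‖ ^ 2 / R.d β) := by
        refine mul_le_mul_of_nonneg_left (Finset.sum_le_sum fun β _ => ?_) (R.d_pos α).le
        refine mul_le_mul_of_nonneg_right (hcol β) ?_
        have := R.d_pos β
        positivity
    _ = R.d α ^ 2 * ∑ β ∈ T, ‖ξ β‖ ^ 2 := by
        rw [Finset.mul_sum, Finset.mul_sum]
        refine Finset.sum_congr rfl fun β _ => ?_
        have := (R.d_pos β).ne'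
        field_simp
    _ ≤ (R.d α * ‖ξ‖) ^ 2 := by
        rw [mul_pow]
        refine mul_le_mul_of_nonneg_left ?_ (sq_nonneg _)
        have := lp.sum_rpow_le_norm_rpow (p := 2) (by norm_num) ξ T
        simpa using this

lemma memℓp_rhoFun (α : I) (ξ : lp (fun _ : I => ℂ) 2) : Memℓp (R.rhoFun α ξ) 2 := by
  refine memℓp_gen' (C := (R.d α * ‖ξ‖) ^ 2) fun S => ?_
  simpa using R.sum_rhoFun_sq_le α ξ S

/-- The bounded operator `ρ(α)` on `ℓ²(I)`, for `α ∈ I`. -/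
noncomputable def rhoBasis (α : I) : lp (fun _ : I => ℂ) 2 →L[ℂ] lp (fun _ : I => ℂ) 2 :=
  LinearMap.mkContinuous
    { toFun := fun ξ => ⟨R.rhoFun α ξ, R.memℓp_rhoFun α ξ⟩
      map_add' := fun ξ ζ => by
        ext η
        change R.rhoFun α (ξ + ζ : lp (fun _ : I => ℂ) 2) η = R.rhoFun α ξ η + R.rhoFun α ζ η
        simp [rhoFun, Finsupp.sum, mul_add, Finset.sum_add_distrib]
      map_smul' := fun c ξ => by
        ext η
        simp [rhoFun, Finsupp.sum, Finset.mul_sum, mul_left_comm] }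
    (R.d α) fun ξ => by
      refine lp.norm_le_of_forall_sum_le (by norm_num)
        (mul_nonneg (R.d_pos α).le (norm_nonneg _)) fun S => ?_
      simpa using R.sum_rhoFun_sq_le α ξ S

lemma rhoBasis_apply (α : I) (ξ : lp (fun _ : I => ℂ) 2) (η : I) :
    R.rhoBasis α ξ η = ∑ β ∈ (R.N η α).support, (R.N η α β : ℂ) * ξ β := rfl

/-- `ρ(α) δ_β = ∑ η, N β ᾱ η δ_η`. -/
lemma rhoBasis_single [DecidableEq I] (α β : I) :
    R.rhoBasis α (lp.single 2 β 1) =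
      (R.N β (R.conj α)).sum fun η n => (n : ℂ) • lp.single 2 η (1 : ℂ) := by
  ext η
  rw [rhoBasis_apply, Finsupp.sum, lp.coeFn_sum, Finset.sum_apply]
  simp only [lp.coeFn_smul, Pi.smul_apply, lp.single_apply, Pi.single_apply, smul_eq_mul, mul_ite,
    mul_one, mul_zero, Finset.sum_ite_eq, Finset.sum_ite_eq', Finsupp.mem_support_iff]
  rw [R.frobenius_right η α β]

lemma rhoBasis_e : R.rhoBasis R.e = 1 := by
  ext ξ η
  rw [rhoBasis_apply, R.mul_e]
  simp

lemma rhoBasis_mul (a b : I) :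
    R.rhoBasis a * R.rhoBasis b = (R.N a b).sum fun c n => (n : ℂ) • R.rhoBasis c := by
  classical
  ext ξ η
  let T : Finset I := ((R.N η a).support.biUnion fun β => (R.N β b).support) ∪
    (R.N a b).support.biUnion fun c => (R.N η c).support
  have hl : ∀ β ∈ (R.N η a).support, R.rhoBasis b ξ β = ∑ γ ∈ T, (R.N β b γ : ℂ) * ξ γ := by
    intro β hβ
    rw [rhoBasis_apply]
    refine Finset.sum_subset (fun γ hγ => Finset.mem_union_left _
      (Finset.mem_biUnion.2 ⟨β, hβ, hγ⟩)) fun γ _ hγ => ?_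
    rw [Finsupp.notMem_support_iff.1 hγ]; simp
  have hr : ∀ c ∈ (R.N a b).support, R.rhoBasis c ξ η = ∑ γ ∈ T, (R.N η c γ : ℂ) * ξ γ := by
    intro c hc
    rw [rhoBasis_apply]
    refine Finset.sum_subset (fun γ hγ => Finset.mem_union_right _
      (Finset.mem_biUnion.2 ⟨c, hc, hγ⟩)) fun γ _ hγ => ?_
    rw [Finsupp.notMem_support_iff.1 hγ]; simp
  have hR : ((R.N a b).sum fun c n => (n : ℂ) • R.rhoBasis c) ξ η
      = ∑ c ∈ (R.N a b).support, (R.N a b c : ℂ) * R.rhoBasis c ξ η := by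
    rw [Finsupp.sum, _root_.sum_apply, lp.coeFn_sum, Finset.sum_apply]
    rfl
  change R.rhoBasis a (R.rhoBasis b ξ) η = _
  have hL' := Finset.sum_congr (rfl : (R.N η a).support = _) fun β hβ =>
    congrArg (fun z => (R.N η a β : ℂ) * z) (hl β hβ)
  have hR' := Finset.sum_congr (rfl : (R.N a b).support = _) fun c hc =>
    congrArg (fun z => (R.N a b c : ℂ) * z) (hr c hc)
  rw [hR, rhoBasis_apply, hL', hR']
  simp only [Finset.mul_sum]
  rw [Finset.sum_comm, Finset.sum_comm (s := (R.N a b).support)]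
  refine Finset.sum_congr rfl fun γ _ => ?_
  have h := congrArg (Nat.cast : ℕ → ℂ) (R.mul_assoc η a b γ)
  simp only [Finsupp.sum, Nat.cast_sum, Nat.cast_mul] at h
  simp only [← _root_.mul_assoc, ← Finset.sum_mul]
  rw [h]

lemma star_rhoBasis (a : I) : star (R.rhoBasis a) = R.rhoBasis (R.conj a) := by
  classical
  ext ξ β
  have h1 : ∀ ζ : lp (fun _ : I => ℂ) 2, ζ β = inner ℂ (lp.single 2 β (1 : ℂ)) ζ := fun ζ => by
    rw [lp.inner_single_left]; simp
  rw [h1, ContinuousLinearMap.star_eq_adjoint, ContinuousLinearMap.adjoint_inner_right,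
    rhoBasis_single, rhoBasis_apply, Finsupp.sum, sum_inner]
  refine Finset.sum_congr rfl fun η _ => ?_
  rw [inner_smul_left, lp.inner_single_left]
  simp

/-- The linear extension of `α ↦ ρ(α)` to `ℂ[I]`. -/
noncomputable def rhoLin : R.Alg ℂ →ₗ[ℂ] (lp (fun _ : I => ℂ) 2 →L[ℂ] lp (fun _ : I => ℂ) 2) :=
  R.ext ℂ R.rhoBasis

lemma rhoLin_mul (x y : R.Alg ℂ) : R.rhoLin (x * y) = R.rhoLin x * R.rhoLin y := by
  induction x using alg_induction with
  | add x x' hx hx' => rw [add_mul, map_add, map_add, hx, hx', add_mul]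
  | smul c x hx => rw [smul_mul_assoc, map_smul, map_smul, hx, smul_mul_assoc]
  | basis ξ =>
  induction y using alg_induction with
  | add x x' hx hx' => rw [mul_add, map_add, map_add, hx, hx', mul_add]
  | smul c x hx => rw [mul_smul_comm, map_smul, map_smul, hx, mul_smul_comm]
  | basis η =>
    rw [basis_mul_basis, basisMul, Finsupp.sum, map_sum]
    simp only [map_smul, rhoLin, ext_basis]
    rw [rhoBasis_mul]; rfl

/-- The right regular representation `ρ` of `ℂ[I]` on `ℓ²(I)`. -/
noncomputable def rho :
    R.Alg ℂ →⋆ₐ[ℂ] (lp (fun _ : I => ℂ) 2 →L[ℂ] lp (fun _ : I => ℂ) 2) :=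
  { AlgHom.ofLinearMap R.rhoLin (by rw [one_def, rhoLin, ext_basis, rhoBasis_e]) R.rhoLin_mul with
    map_star' := fun x => by
      change R.rhoLin (star x) = star (R.rhoLin x)
      induction x using alg_induction with
      | add x x' hx hx' => rw [star_add, map_add, map_add, hx, hx', star_add]
      | smul c x hx => rw [star_smul, map_smul, map_smul, hx, star_smul]
      | basis ξ => rw [star_basis, rhoLin, ext_basis, ext_basis, star_rhoBasis] }

lemma rho_basis (α : I) : R.rho (R.basis ℂ α) = R.rhoBasis α := ext_basis _ _

end Regular

end FusionAlgebra

/-! The fusion algebra of `SU_q(2)` -/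

/-- The `q`-numbers `[x]_q = (q^{-x} - q^x) / (q^{-1} - q)` for `0 < q < 1`, and `[x]_1 = x`. -/
noncomputable def qNumber (q x : ℝ) : ℝ :=
  if q = 1 then x else (q ^ (-x) - q ^ x) / (q⁻¹ - q)

namespace SUq2

/-- The sequence with terms `1`, `x` and `u (n + 2) = x * u (n + 1) - u n`. -/
def chain {A : Type*} [CommRing A] (x : A) : ℕ → A
  | 0 => 1
  | 1 => x
  | n + 2 => x * chain x (n + 1) - chain x n

/-- The quantum dimension function of `SU_q(2)`: the one with `d 0 = 1`, `d 1 = q + q⁻¹` and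
`d n * d 1 = d (n - 1) + d (n + 1)`. -/
noncomputable def qdim (q : ℝ) : ℕ → ℝ := chain (q + q⁻¹)

/-- The fusion rules `m ⊗ n = |m - n| ⊕ (|m - n| + 2) ⊕ ⋯ ⊕ (m + n)`. -/
noncomputable def fusion (m n : ℕ) : ℕ →₀ ℕ :=
  ∑ j ∈ Finset.range (min m n + 1), Finsupp.single (max m n - min m n + 2 * j) 1

lemma fusion_apply (m n k : ℕ) :
    fusion m n k = if m ≤ n + k ∧ n ≤ m + k ∧ k ≤ m + n ∧ (m + n + k) % 2 = 0 then 1 else 0 := by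
  rw [fusion, Finsupp.finsetSum_apply]
  simp only [Finsupp.single_apply]
  split_ifs with h
  · rw [Finset.sum_eq_single ((k - (max m n - min m n)) / 2)]
    · rw [if_pos (by omega)]
    · intro j _ hj
      rw [if_neg (by omega)]
    · intro hj
      rw [Finset.mem_range] at hj
      omega
  · refine Finset.sum_eq_zero fun j hj => ?_
    rw [Finset.mem_range] at hj
    rw [if_neg (by omega)]

lemma chain_add_mul {A : Type*} [CommRing A] (x : A) (n : ℕ) : ∀ m : ℕ,
    chain x (m + n) * chain x n = ∑ j ∈ Finset.range (n + 1), chain x (m + 2 * j) := by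
  induction n using Nat.strong_induction_on with
  | _ n ih =>
  intro m
  match n, ih with
  | 0, _ => simp [chain]
  | 1, _ =>
    rw [Finset.sum_range_succ, Finset.sum_range_one]
    simp only [chain]; ring_nf
  | n + 2, ih =>
    have h1 := ih (n + 1) (by omega) (m + 1)
    have h0 := ih n (by omega) (m + 2)
    have e1 : chain x (n + 2) = x * chain x (n + 1) - chain x n := rfl
    have e2 : ∀ j, chain x (m + 2 + 2 * j) = x * chain x (m + 1 + 2 * j) - chain x (m + 2 * j) := by
      intro j
      have : m + 2 + 2 * j = (m + 2 * j) + 2 := by ring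
      rw [this, show m + 1 + 2 * j = (m + 2 * j) + 1 by ring]
      rfl
    have h2 : ∑ j ∈ Finset.range (n + 2), chain x (m + 2 + 2 * j)
        = x * (∑ j ∈ Finset.range (n + 2), chain x (m + 1 + 2 * j))
          - ∑ j ∈ Finset.range (n + 2), chain x (m + 2 * j) := by
      rw [Finset.mul_sum, ← Finset.sum_sub_distrib]
      exact Finset.sum_congr rfl fun j _ => e2 j
    rw [show m + 1 + (n + 1) = m + (n + 2) by ring] at h1
    rw [show m + 2 + n = m + (n + 2) by ring] at h0
    rw [Finset.sum_range_succ _ (n + 1)] at h2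
    rw [Finset.sum_range_succ _ (n + 2), show m + 2 * (n + 2) = m + 2 + 2 * (n + 1) by ring, e1]
    linear_combination x * h1 - h0 - h2

lemma chain_mul {A : Type*} [CommRing A] (x : A) (m n : ℕ) :
    chain x m * chain x n = (fusion m n).sum fun k c => (c : A) * chain x k := by
  have h : ((fusion m n).sum fun k c => (c : A) * chain x k)
      = ∑ j ∈ Finset.range (min m n + 1), chain x (max m n - min m n + 2 * j) := by
    rw [fusion, ← Finsupp.sum_finsetSum_index (by simp) (by intros; push_cast; ring)]
    exact Finset.sum_congr rfl fun j _ => by rw [Finsupp.sum_single_index] <;> simp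
  rw [h, ← chain_add_mul]
  rcases le_total m n with hmn | hmn
  · rw [max_eq_right hmn, min_eq_left hmn, Nat.sub_add_cancel hmn, mul_comm]
  · rw [max_eq_left hmn, min_eq_right hmn, Nat.sub_add_cancel hmn]

lemma one_le_chain {x : ℝ} (hx : 2 ≤ x) (n : ℕ) :
    1 ≤ chain x n ∧ chain x n ≤ chain x (n + 1) := by
  induction n with
  | zero => exact ⟨le_refl _, by change (1 : ℝ) ≤ x; linarith⟩
  | succ n ih =>
    refine ⟨ih.1.trans ih.2, ?_⟩
    change _ ≤ x * chain x (n + 1) - chain x n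
    nlinarith [ih.1, ih.2]

open Polynomial in
lemma chain_X_monic (n : ℕ) : (chain (X : ℤ[X]) n).Monic ∧ (chain (X : ℤ[X]) n).natDegree = n := by
  induction n using Nat.strong_induction_on with
  | _ n ih =>
  match n, ih with
  | 0, _ => exact ⟨monic_one, natDegree_one⟩
  | 1, _ => exact ⟨monic_X, natDegree_X⟩
  | n + 2, ih =>
    obtain ⟨m1, d1⟩ := ih (n + 1) (by omega)
    obtain ⟨m0, d0⟩ := ih n (by omega)
    have hm : ((X : ℤ[X]) * chain X (n + 1)).Monic := monic_X.mul m1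
    have hd : ((X : ℤ[X]) * chain X (n + 1)).natDegree = n + 2 := by
      rw [natDegree_X_mul m1.ne_zero, d1]
    have hlt : (chain (X : ℤ[X]) n).degree < ((X : ℤ[X]) * chain X (n + 1)).degree := by
      rw [degree_eq_natDegree m0.ne_zero, degree_eq_natDegree hm.ne_zero, d0, hd]
      exact_mod_cast (by omega : n < n + 2)
    refine ⟨hm.sub_of_left hlt, ?_⟩
    change (X * chain X (n + 1) - chain X n : ℤ[X]).natDegree = _
    rw [natDegree_eq_of_degree_eq (degree_sub_eq_left_of_degree_lt hlt), hd]

open Polynomial in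
lemma chain_X_linearIndependent : LinearIndependent ℤ (chain (X : ℤ[X])) := by
  let S : Polynomial.Sequence ℤ := ⟨chain X, fun n => by
    rw [degree_eq_natDegree (chain_X_monic n).1.ne_zero, (chain_X_monic n).2]⟩
  exact S.linearIndependent

open Polynomial in
/-- Associativity of the fusion rules, by comparing coefficients of the products of the monic
polynomials `chain X n`. -/
lemma fusion_assoc (m n p r : ℕ) :
    ((fusion m n).sum fun k c => c * fusion k p r)
      = (fusion n p).sum fun k c => c * fusion m k r := by
  let L : (ℕ →₀ ℤ) →ₗ[ℤ] ℤ[X] := Finsupp.linearCombination ℤ (chain (X : ℤ[X]))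
  have hinj : Function.Injective L := chain_X_linearIndependent
  let c : (ℕ →₀ ℕ) → (ℕ →₀ ℤ) := Finsupp.mapRange (Nat.cast : ℕ → ℤ) Nat.cast_zero
  have hc : ∀ a b, L (c (fusion a b)) = chain X a * chain X b := by
    intro a b
    rw [chain_mul, Finsupp.linearCombination_apply, Finsupp.sum_mapRange_index (by simp)]
    exact Finset.sum_congr rfl fun k _ => by simp
  have key : (∑ k ∈ (fusion m n).support, (fusion m n k : ℤ) • c (fusion k p))
      = ∑ k ∈ (fusion n p).support, (fusion n p k : ℤ) • c (fusion m k) := by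
    apply hinj
    simp only [map_sum, map_smul, hc]
    have h := mul_assoc (chain (X : ℤ[X]) m) (chain X n) (chain X p)
    rw [chain_mul X m n, chain_mul X n p, Finsupp.sum, Finsupp.sum, Finset.sum_mul,
      Finset.mul_sum] at h
    convert h using 2 with k _ k _
    · simp [mul_assoc]
    · simp [mul_left_comm]
  have := DFunLike.congr_fun key r
  simp only [Finsupp.finsetSum_apply, Finsupp.smul_apply, smul_eq_mul, c,
    Finsupp.mapRange_apply] at this
  unfold Finsupp.sum
  exact_mod_cast this

end SUq2

/-- The fusion algebra `R(SU_q(2))`: irreducible objects `ℕ`, unit `0`, trivial involution, the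
fusion rules of `SU(2)`, and the quantum dimension function. -/
noncomputable def fusionAlgebraSUq2 (q : ℝ) (hq : 0 < q) : FusionAlgebra ℕ where
  e := 0
  conj n := n
  N := SUq2.fusion
  d := SUq2.qdim q
  conj_conj _ := rfl
  e_mul n := by simp [SUq2.fusion]
  mul_e n := by simp [SUq2.fusion]
  mul_assoc := SUq2.fusion_assoc
  conj_mul m n k := by
    rw [SUq2.fusion_apply, SUq2.fusion_apply]; congr 1; apply propext; omega
  frobenius_right m n k := by
    rw [SUq2.fusion_apply, SUq2.fusion_apply]; congr 1; apply propext; omega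
  frobenius_left m n k := by
    rw [SUq2.fusion_apply, SUq2.fusion_apply]; congr 1; apply propext; omega
  d_mul m n := SUq2.chain_mul _ m n
  d_conj _ := rfl
  one_le_d n := by
    have h : 2 ≤ q + q⁻¹ := by
      have h1 : q * q⁻¹ = 1 := mul_inv_cancel₀ hq.ne'
      nlinarith [sq_nonneg (q - 1), inv_pos.2 hq, sq_nonneg (q - q⁻¹), sq_nonneg (q + q⁻¹ - 2)]
    exact (SUq2.one_le_chain h n).1

/-! ### Growth of the quantum dimensions -/

namespace SUq2

/-- Monotonicity of d(n)/(n + 1), with equality throughout at x = 2. In the induction the recurrence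
leaves the surplus (n + 2)(x - 2) d(n + 1) ≥ 0. -/
lemma chain_ratio {x : ℝ} (hx : 2 ≤ x) (n : ℕ) :
    ((n : ℝ) + 2) * chain x n ≤ (n + 1) * chain x (n + 1) := by
  induction n with
  | zero => simpa [chain] using hx
  | succ n ih =>
    have e : chain x (n + 1 + 1) = x * chain x (n + 1) - chain x n := rfl
    have h1 := (one_le_chain hx (n + 1)).1
    have h2 : (0 : ℝ) ≤ ((n : ℝ) + 2) * ((x - 2) * chain x (n + 1)) :=
      mul_nonneg (by positivity) (mul_nonneg (by linarith) (by linarith))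
    rw [e]
    push_cast
    nlinarith [ih, h2]

/-- The monotone ratio compared with its value x/2 at index 1. The shift to n + 1 matters: at index
0 the analogous bound would read x ≤ 2. -/
lemma add_two_mul_le_chain {x : ℝ} (hx : 2 ≤ x) (n : ℕ) :
    ((n : ℝ) + 2) * x ≤ 2 * chain x (n + 1) := by
  induction n with
  | zero => simp [chain]
  | succ n ih =>
    have h := chain_ratio hx (n + 1)
    have hn : (0 : ℝ) < (n : ℝ) + 2 := by positivity
    push_cast at h ⊢
    refine le_of_mul_le_mul_left ?_ hn
    have h3 : (0 : ℝ) ≤ (n : ℝ) + 3 := by positivity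
    nlinarith [mul_le_mul_of_nonneg_left ih h3]

lemma two_le_add_inv {q : ℝ} (hq : 0 < q) : 2 ≤ q + q⁻¹ := by
  have h : q + q⁻¹ - 2 = (q - 1) ^ 2 / q := by field_simp; ring
  have : 0 ≤ (q - 1) ^ 2 / q := by positivity
  linarith

lemma chain_two (n : ℕ) : chain (2 : ℝ) n = n + 1 := by
  induction n using Nat.strong_induction_on with
  | _ n ih =>
  match n, ih with
  | 0, _ => simp [chain]
  | 1, _ => norm_num [chain]
  | n + 2, ih =>
    change 2 * chain (2 : ℝ) (n + 1) - chain 2 n = _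
    rw [ih (n + 1) (by omega), ih n (by omega)]
    push_cast; ring

end SUq2

lemma qNumber_two {q : ℝ} (hq0 : 0 < q) (hq1 : q ≤ 1) : qNumber q 2 = q + q⁻¹ := by
  unfold qNumber
  split_ifs with h
  · subst h; norm_num
  · have h1 : q < 1 := lt_of_le_of_ne hq1 h
    -- The numerator is a difference of squares, and this is the factor to cancel.
    have h2 : q⁻¹ - q ≠ 0 := by
      have := (one_lt_inv₀ hq0).2 h1
      exact sub_ne_zero.2 (by linarith)
    rw [div_eq_iff h2, Real.rpow_neg hq0.le]
    norm_num
    ring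

/-! ### Norm of ρ(n) and the lower bound -/

namespace fusionAlgebraSUq2

open FusionAlgebra

variable {q : ℝ} (hq : 0 < q)

lemma d_one : (fusionAlgebraSUq2 q hq).d 1 = q + q⁻¹ := rfl

/-- The bound by the dimension holds for any dimension function on the same fusion rules; the one at
q = 1 is the best available here. -/
lemma norm_rhoBasis_le (n : ℕ) : ‖(fusionAlgebraSUq2 q hq).rhoBasis n‖ ≤ n + 1 := by
  refine ContinuousLinearMap.opNorm_le_bound _ (by positivity) fun ξ => ?_
  have h : ‖(fusionAlgebraSUq2 1 one_pos).rhoBasis n ξ‖ ≤ (fusionAlgebraSUq2 1 one_pos).d n * ‖ξ‖ :=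
    LinearMap.mkContinuous_norm_le _ ((fusionAlgebraSUq2 1 one_pos).d_pos n).le _ |>
      fun h => ContinuousLinearMap.le_of_opNorm_le _ h ξ
  have hd : (fusionAlgebraSUq2 1 one_pos).d n = n + 1 := by
    change SUq2.chain (1 + 1⁻¹ : ℝ) n = _
    rw [← SUq2.chain_two]; norm_num
  rw [hd] at h
  -- The operators for q and for 1 agree definitionally, as `rhoFun` only involves the
  -- multiplicities.
  exact h

/-- Reverse triangle inequality: the displacement is at least d(n + 1) - (n + 2), and (n + 2)/d(n +
1) ≤ 2/d(1). -/
lemma one_sub_le_norm_rhoBasis_sub (n : ℕ) {ξ : lp (fun _ : ℕ => ℂ) 2} (hξ : ‖ξ‖ = 1) :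
    1 - 2 / (q + q⁻¹) ≤ ‖(fusionAlgebraSUq2 q hq).rho ((fusionAlgebraSUq2 q hq).basis ℂ (n + 1)) ξ
      - ((fusionAlgebraSUq2 q hq).d (n + 1) : ℂ) • ξ‖ / (fusionAlgebraSUq2 q hq).d (n + 1) := by
  rw [rho_basis]
  have hd := (fusionAlgebraSUq2 q hq).d_pos (n + 1)
  have hx := SUq2.two_le_add_inv hq
  have h1 := ContinuousLinearMap.le_of_opNorm_le _ (norm_rhoBasis_le hq (n + 1)) ξ
  have h2 := norm_sub_norm_le (((fusionAlgebraSUq2 q hq).d (n + 1) : ℂ) • ξ)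
    ((fusionAlgebraSUq2 q hq).rhoBasis (n + 1) ξ)
  rw [norm_sub_rev, norm_smul, Complex.norm_real, Real.norm_of_nonneg hd.le, hξ] at h2
  rw [hξ] at h1
  push_cast at h1
  have h3 : ((n : ℝ) + 2) * (q + q⁻¹) ≤ 2 * (fusionAlgebraSUq2 q hq).d (n + 1) :=
    SUq2.add_two_mul_le_chain hx n
  rw [le_div_iff₀ hd]
  have h4 : (n : ℝ) + 2 ≤ 2 / (q + q⁻¹) * (fusionAlgebraSUq2 q hq).d (n + 1) := by
    rw [div_mul_eq_mul_div, le_div_iff₀ (by linarith)]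
    exact h3
  linarith

/-! ### Generating sets -/

/-- Otherwise X ⊆ {0}, every word in X is the unit, and the object 1 is never reached. -/
lemma exists_succ_mem_of_generates {X : Finset ℕ} (hX : (fusionAlgebraSUq2 q hq).Generates X) :
    ∃ n, n + 1 ∈ X := by
  by_contra! h
  obtain ⟨l, -, hl, hc⟩ := hX.2 1
  have h0 : ∀ y ∈ l.map ((fusionAlgebraSUq2 q hq).basis ℤ), y = 1 := by
    intro y hy
    obtain ⟨x, hx, rfl⟩ := List.mem_map.1 hy
    cases x with
    | zero => rfl
    | succ n => exact absurd (hl _ hx) (h n)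
  rw [List.prod_eq_one h0, one_def, basis_apply] at hc
  exact hc (if_neg (show (0 : ℕ) ≠ 1 by omega))

lemma coeff_basis_one_mul {k : Type*} [CommRing k] (x : (fusionAlgebraSUq2 q hq).Alg k) (n : ℕ) :
    coeff ((fusionAlgebraSUq2 q hq).basis k 1 * x) (n + 1) = coeff x n + coeff x (n + 2) := by
  induction x using alg_induction with
  | add x y hx hy =>
    rw [mul_add]
    refine (congrArg₂ (· + ·) hx hy).trans ?_
    exact add_add_add_comm _ _ _ _
  | smul c x hx =>
    rw [mul_smul_comm]
    refine (congrArg (c * ·) hx).trans ?_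
    exact mul_add _ _ _
  | basis m =>
    rw [basis_mul_basis, basisMul_apply, basis_apply, basis_apply]
    change ((SUq2.fusion 1 m (n + 1) : ℕ) : k) = _
    rw [SUq2.fusion_apply]
    by_cases h1 : m = n
    · rw [if_pos (by omega), if_pos h1, if_neg (by omega)]; simp
    · by_cases h2 : m = n + 2
      · rw [if_pos (by omega), if_neg h1, if_pos h2]; simp
      · rw [if_neg (by omega), if_neg h1, if_neg h2]; simp

/-- The n-th power of the fundamental object has leading term n with coefficient 1. The vanishing
above n is carried along because the induction also needs the coefficient at n + j + 2. -/
lemma coeff_basis_one_pow {k : Type*} [CommRing k] (n j : ℕ) :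
    coeff ((fusionAlgebraSUq2 q hq).basis k 1 ^ n) (n + j) = if j = 0 then 1 else 0 := by
  induction n generalizing j with
  | zero =>
    rw [pow_zero, one_def, basis_apply]
    change (if 0 = 0 + j then (1 : k) else 0) = _
    congr 1
    apply propext
    omega
  | succ n ih =>
    rw [pow_succ', show n + 1 + j = (n + j) + 1 by ring, coeff_basis_one_mul, ih,
      show n + j + 2 = n + (j + 2) by ring, ih]
    simp

lemma generates_singleton_one : (fusionAlgebraSUq2 q hq).Generates {1} := by
  refine ⟨fun x hx => hx, fun α => ?_⟩
  cases α with
  | zero =>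
    -- Words must be nonempty, so the unit is found inside 1 ⊗ 1 = 0 ⊕ 2.
    refine ⟨[1, 1], by simp, by simp, ?_⟩
    simp only [List.map_cons, List.map_nil, List.prod_cons, List.prod_nil, mul_one]
    rw [basis_mul_basis, basisMul_apply]
    change ((SUq2.fusion 1 1 0 : ℕ) : ℤ) ≠ 0
    rw [SUq2.fusion_apply]
    simp
  | succ n =>
    refine ⟨List.replicate (n + 1) 1, by simp, by simp, ?_⟩
    rw [List.map_replicate, List.prod_replicate]
    have := coeff_basis_one_pow hq (k := ℤ) (n + 1) 0
    rw [add_zero, if_pos rfl] at this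
    rw [this]
    exact one_ne_zero

/-! ### Invariant vectors -/

lemma fix_rho : (fusionAlgebraSUq2 q hq).fix (fusionAlgebraSUq2 q hq).rho = {0} := by
  refine Set.eq_singleton_iff_unique_mem.2 ⟨fun α => by simp, fun ξ hξ => ?_⟩
  -- Since 0 ⊗ n = n, the value of ρ(n)ξ at 0 is ξ(n); evaluate the invariance equation there.
  have h1 : ∀ n, ξ n = ((fusionAlgebraSUq2 q hq).d n : ℂ) * ξ 0 := by
    intro n
    have h := congrArg (fun ζ : lp (fun _ : ℕ => ℂ) 2 => ζ 0) (hξ n)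
    simp only [rho_basis, rhoBasis_apply] at h
    rw [show (fusionAlgebraSUq2 q hq).N 0 n = Finsupp.single n 1 from
      (fusionAlgebraSUq2 q hq).e_mul n,
      Finsupp.support_single n one_ne_zero, Finset.sum_singleton, Finsupp.single_eq_same,
      Nat.cast_one, one_mul] at h
    exact h
  have h2 : ∀ n, ‖ξ 0‖ ^ 2 ≤ ‖ξ n‖ ^ 2 := by
    intro n
    refine pow_le_pow_left₀ (norm_nonneg _) ?_ 2
    rw [h1 n, norm_mul, Complex.norm_real,
      Real.norm_of_nonneg ((fusionAlgebraSUq2 q hq).d_pos n).le]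
    exact le_mul_of_one_le_left (norm_nonneg _) ((fusionAlgebraSUq2 q hq).one_le_d n)
  have h3 : Summable fun n => ‖ξ n‖ ^ 2 := by
    have := (lp.memℓp ξ).summable (by norm_num)
    simpa using this
  have h4 : ‖ξ 0‖ ^ 2 ≤ 0 :=
    ge_of_tendsto h3.tendsto_atTop_zero (Filter.Eventually.of_forall h2)
  have h5 : ξ 0 = 0 := by
    have := pow_eq_zero_iff (two_ne_zero) |>.1 (le_antisymm h4 (by positivity))
    exact norm_eq_zero.1 this
  ext n
  rw [h1 n, h5]
  simp

/-! ### Almost invariant vectors for ρ(1) -/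

lemma rhoBasis_one_single_zero :
    (fusionAlgebraSUq2 q hq).rhoBasis 1 (lp.single 2 0 1) = lp.single 2 1 1 := by
  rw [rhoBasis_single]
  change ((SUq2.fusion 0 1).sum _) = _
  simp [SUq2.fusion]

lemma rhoBasis_one_single_succ (n : ℕ) :
    (fusionAlgebraSUq2 q hq).rhoBasis 1 (lp.single 2 (n + 1) 1)
      = lp.single 2 n 1 + lp.single 2 (n + 2) 1 := by
  rw [rhoBasis_single]
  change ((SUq2.fusion (n + 1) 1).sum _) = _
  have h : SUq2.fusion (n + 1) 1 = Finsupp.single n 1 + Finsupp.single (n + 2) 1 := by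
    simp [SUq2.fusion, Finset.sum_range_succ]
  rw [h, Finsupp.sum_add_index' (by simp) (by intros; push_cast; rw [add_smul])]
  simp

/-- Every interior point of the segment has both neighbours in it, so the defect from the eigenvalue
2 lives at the ends: one missing neighbour at 0, one at m, and a spill to m + 1. Its norm is bounded
independently of m. -/
lemma rhoBasis_one_sum_single (m : ℕ) :
    (fusionAlgebraSUq2 q hq).rhoBasis 1 (∑ k ∈ Finset.range (m + 1), lp.single 2 k 1)
      = (2 : ℂ) • (∑ k ∈ Finset.range (m + 1), lp.single 2 k 1)
        + (lp.single 2 (m + 1) 1 - lp.single 2 m 1 - lp.single 2 0 1) := by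
  induction m with
  | zero =>
    simp only [zero_add, Finset.sum_range_one, rhoBasis_one_single_zero]
    module
  | succ m ih =>
    rw [Finset.sum_range_succ, map_add, ih, rhoBasis_one_single_succ]
    module

lemma norm_sum_single (m : ℕ) :
    ‖(∑ k ∈ Finset.range m, lp.single 2 k 1 : lp (fun _ : ℕ => ℂ) 2)‖ = √m := by
  have h := lp.norm_sum_single (p := 2) (E := fun _ : ℕ => ℂ) (by norm_num) (fun _ => (1 : ℂ))
    (Finset.range m)
  rw [eq_comm, Real.sqrt_eq_iff_mul_self_eq (by positivity) (norm_nonneg _)]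
  simp at h
  rw [← sq, h]

/-- The witness is the indicator of {0, …, m} divided by its norm √(m + 1); the 3 counts the
boundary vectors. -/
lemma exists_unit_norm_rhoBasis_one_sub_le (m : ℕ) : ∃ ξ : lp (fun _ : ℕ => ℂ) 2, ‖ξ‖ = 1 ∧
    ‖(fusionAlgebraSUq2 q hq).rhoBasis 1 ξ - ((q + q⁻¹ : ℝ) : ℂ) • ξ‖
      ≤ (q + q⁻¹ - 2) + 3 * (1 / √((m : ℝ) + 1)) := by
  have hx := SUq2.two_le_add_inv hq
  set v : lp (fun _ : ℕ => ℂ) 2 := ∑ k ∈ Finset.range (m + 1), lp.single 2 k 1 with hv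
  set s : ℝ := √((m : ℝ) + 1) with hs
  have hs0 : 0 < s := Real.sqrt_pos.2 (by positivity)
  have hvs : ‖v‖ = s := by rw [hv, norm_sum_single]; push_cast; rfl
  have hn : ‖((s⁻¹ : ℝ) : ℂ)‖ = s⁻¹ := by
    rw [Complex.norm_real, Real.norm_of_nonneg (inv_nonneg.2 hs0.le)]
  refine ⟨((s⁻¹ : ℝ) : ℂ) • v, ?_, ?_⟩
  · rw [norm_smul, hn, hvs, inv_mul_cancel₀ hs0.ne']
  · have hsingle : ∀ k : ℕ, ‖(lp.single 2 k 1 : lp (fun _ : ℕ => ℂ) 2)‖ = 1 := fun k => by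
      rw [lp.norm_single (by norm_num)]; simp
    -- The eigenvalue part 2v is absorbed into (q + q⁻¹)v, leaving the boundary term and (q + q⁻¹ -
    -- 2)v.
    have key : (fusionAlgebraSUq2 q hq).rhoBasis 1 (((s⁻¹ : ℝ) : ℂ) • v)
        - ((q + q⁻¹ : ℝ) : ℂ) • ((s⁻¹ : ℝ) : ℂ) • v
        = ((s⁻¹ : ℝ) : ℂ) • ((lp.single 2 (m + 1) 1 - lp.single 2 m 1 - lp.single 2 0 1)
          - ((q + q⁻¹ - 2 : ℝ) : ℂ) • v) := by
      rw [map_smul, hv, rhoBasis_one_sum_single]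
      push_cast
      module
    rw [key, norm_smul, hn]
    have h3 : ‖(lp.single 2 (m + 1) 1 - lp.single 2 m 1 - lp.single 2 0 1 :
        lp (fun _ : ℕ => ℂ) 2)‖ ≤ 3 := by
      refine (norm_sub_le _ _).trans ?_
      have := norm_sub_le (lp.single 2 (m + 1) 1 : lp (fun _ : ℕ => ℂ) 2) (lp.single 2 m 1)
      rw [hsingle, hsingle] at this
      rw [hsingle]
      linarith
    have h4 : ‖((q + q⁻¹ - 2 : ℝ) : ℂ) • v‖ = (q + q⁻¹ - 2) * s := by
      rw [norm_smul, hvs, Complex.norm_real, Real.norm_of_nonneg (by linarith)]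
    calc s⁻¹ * _ ≤ s⁻¹ * (3 + (q + q⁻¹ - 2) * s) := by
          refine mul_le_mul_of_nonneg_left ?_ (inv_nonneg.2 hs0.le)
          refine (norm_sub_le _ _).trans ?_
          rw [h4]; linarith
      _ = _ := by field_simp; ring

/-! ### The value of the Kazhdan constant -/

lemma kaz_rho :
    (fusionAlgebraSUq2 q hq).kaz (fusionAlgebraSUq2 q hq).rho = 1 - 2 / (q + q⁻¹) := by
  have hx := SUq2.two_le_add_inv hq
  have hx0 : 0 < q + q⁻¹ := by linarith
  -- A real infimum over an empty type is 0 by convention, so both index types must be shown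
  -- inhabited for the lower bound.
  have hunit : Nonempty {ξ : lp (fun _ : ℕ => ℂ) 2 // ‖ξ‖ = 1} :=
    let ⟨ξ, hξ, _⟩ := exists_unit_norm_rhoBasis_one_sub_le hq 0
    ⟨⟨ξ, hξ⟩⟩
  have hgen : Nonempty {X : Finset ℕ // (fusionAlgebraSUq2 q hq).Generates X} :=
    ⟨⟨_, generates_singleton_one hq⟩⟩
  have hlow : ∀ X, (fusionAlgebraSUq2 q hq).Generates X →
      1 - 2 / (q + q⁻¹) ≤ (fusionAlgebraSUq2 q hq).kazOn X (fusionAlgebraSUq2 q hq).rho := by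
    intro X hX
    obtain ⟨n, hn⟩ := exists_succ_mem_of_generates hq hX
    refine le_ciInf fun ξ => ?_
    refine (one_sub_le_norm_rhoBasis_sub hq n ξ.2).trans ?_
    exact le_ciSup (f := fun α : X => ‖(fusionAlgebraSUq2 q hq).rho
      ((fusionAlgebraSUq2 q hq).basis ℂ (α : ℕ)) (ξ : lp (fun _ : ℕ => ℂ) 2)
      - ((fusionAlgebraSUq2 q hq).d α : ℂ) • (ξ : lp (fun _ : ℕ => ℂ) 2)‖
        / (fusionAlgebraSUq2 q hq).d α) (Set.finite_range _).bddAbove ⟨n + 1, hn⟩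
  refine le_antisymm ?_ (le_ciInf fun X => hlow X.1 X.2)
  -- The upper bound tests the infimum at X = {1}; `hlow` also supplies the boundedness below that
  -- this requires.
  refine (ciInf_le (f := fun X : {X : Finset ℕ // (fusionAlgebraSUq2 q hq).Generates X} =>
    (fusionAlgebraSUq2 q hq).kazOn X (fusionAlgebraSUq2 q hq).rho)
    ⟨_, Set.forall_mem_range.2 fun X => hlow X.1 X.2⟩ ⟨_, generates_singleton_one hq⟩).trans ?_
  have hlim : Filter.Tendsto
      (fun m : ℕ => ((q + q⁻¹ - 2) + 3 * (1 / √((m : ℝ) + 1))) / (q + q⁻¹)) Filter.atTop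
      (nhds (((q + q⁻¹ - 2) + 3 * 0) / (q + q⁻¹))) := by
    refine ((Filter.Tendsto.const_mul 3 ?_).const_add _).div_const _
    have h := (Real.continuous_sqrt.tendsto 0).comp
      (tendsto_one_div_add_atTop_nhds_zero_nat (𝕜 := ℝ))
    rw [Real.sqrt_zero] at h
    refine h.congr fun m => ?_
    simp
  rw [show 1 - 2 / (q + q⁻¹) = ((q + q⁻¹ - 2) + 3 * 0) / (q + q⁻¹) by
    rw [mul_zero, add_zero, sub_div, div_self hx0.ne']]
  -- It suffices to bound the infimum over unit vectors by each term of a sequence converging to the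
  -- claimed value.
  refine ge_of_tendsto hlim (Filter.Eventually.of_forall fun m => ?_)
  obtain ⟨ξ, hξ, hle⟩ := exists_unit_norm_rhoBasis_one_sub_le hq m
  refine (ciInf_le ⟨0, Set.forall_mem_range.2 fun ξ => Real.iSup_nonneg fun α => ?_⟩
    ⟨ξ, hξ⟩).trans ?_
  · exact div_nonneg (norm_nonneg _) ((fusionAlgebraSUq2 q hq).d_pos _).le
  · have : Nonempty ({1} : Finset ℕ) := ⟨⟨1, by simp⟩⟩
    refine ciSup_le fun α => ?_
    obtain ⟨α, hα⟩ := α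
    obtain rfl := Finset.mem_singleton.1 hα
    simp only [rho_basis, d_one]
    exact div_le_div_of_nonneg_right hle hx0.le

end fusionAlgebraSUq2

theorem proposition11 (q : ℝ) (hq0 : 0 < q) (hq1 : q ≤ 1) :
    (∃ X : Finset ℕ, (fusionAlgebraSUq2 q hq0).Generates X) ∧
    (fusionAlgebraSUq2 q hq0).fix (fusionAlgebraSUq2 q hq0).rho = {0} ∧
    (fusionAlgebraSUq2 q hq0).kaz (fusionAlgebraSUq2 q hq0).rho = 1 - 2 / qNumber q 2 ∧
    1 - 2 / qNumber q 2 = (1 - q) ^ 2 / (q ^ 2 + 1) := by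
  refine ⟨⟨_, fusionAlgebraSUq2.generates_singleton_one hq0⟩, fusionAlgebraSUq2.fix_rho hq0, ?_, ?_⟩
  · rw [qNumber_two hq0 hq1, fusionAlgebraSUq2.kaz_rho]
  · rw [qNumber_two hq0 hq1]
    field_simp
    ring
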